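/- Let $\mathcal{O}=\mathcal{O}_{3,3,3,3}$ be the closed orbifold with underlying space $S^2$ and four cone points of order $3$, with orbifold fundamental group $$\pi_1(\mathcal{O})=\langle \gamma_1,\gamma_2,\gamma_3,\gamma_4 \mid \gamma_1^3=\gamma_2^3=\gamma_3^3=\gamma_4^3=\gamma_1\gamma_2\gamma_3\gamma_4=1\rangle .$$ Let $x,y\in PSL(2,\mathbb{R})$ be the classes of $$\begin{pmatrix}0&-1\\1&1\end{pmatrix},\qquad \begin{pmatrix}0&-1-\sqrt2\\-1+\sqrt2&\sqrt2\end{pmatrix},$$ which satisfy $x^3=y^4=(xy)^4=1$ and generate the triangle group $\Delta(3,4,4)$, and let $\sigma\colon \pi_1(\mathcal{O})\to\Delta(3,4,4)<PSL(2,\mathbb{R})$ be the representation with $\sigma(\gamma_i)=y^{i-1}xy^{-(i-1)}$ for $i=1,2,3,4$. Let $n=2k+1$ be odd and let $\omega_n\colon PSL(2,\mathbb{R})\to PSL(n,\mathbb{R})=SL(n,\mathbb{R})$ be the irreducible representation induced by the action of $SL(2,\mathbb{R})$ on real homogeneous polynomials of degree $n-1$ in two variables by linear substitution. Let $\rho\colon\pi_1(\mathcal{O})\to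 SL(n,\mathbb{Z})<SL(n,\mathbb{R})$ be an integral representation that is conjugate over $\mathbb{R}$ to $\omega_n\circ\sigma$. Let $\gamma\subset\mathcal{O}$ be a simple closed curve dividing $\mathcal{O}$ into two orbifolds $\mathcal{O}_L$ and $\mathcal{O}_R$ with common boundary $\gamma$ and two cone points of order $3$ each. That is, up to an automorphism $\varphi$ of $\pi_1(\mathcal{O})$, $$[\gamma]=\varphi(\gamma_1\gamma_2),\qquad \pi_1(\mathcal{O}_L)=\varphi(\langle\gamma_1,\gamma_2\rangle),\qquad \pi_1(\mathcal{O}_R)=\varphi(\langle\gamma_3,\gamma_4\rangle).$$ Then the restrictions of $\rho$ to $\pi_1(\mathcal{O}_L)$ and to $\pi_1(\mathcal{O}_R)$ are irreducible, as representations on $\mathbb{R}^n$. (This is asserted for every automorphism $\varphi$.) -/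

import Mathlib

open scoped MatrixGroups

noncomputable section

namespace Orbifold3333

/-! ### The orbifold fundamental group -/

/-- The relators `γᵢ³` (`i = 0, 1, 2, 3`) and `γ₀ γ₁ γ₂ γ₃`. -/
def relators : Set (FreeGroup (Fin 4)) :=
  Set.range (fun i : Fin 4 => FreeGroup.of i ^ 3) ∪
    {FreeGroup.of 0 * FreeGroup.of 1 * FreeGroup.of 2 * FreeGroup.of 3}

/-- The orbifold fundamental group of the sphere with four cone points of order `3`:
`⟨γ₀, γ₁, γ₂, γ₃ | γ₀³ = γ₁³ = γ₂³ = γ₃³ = γ₀ γ₁ γ₂ γ₃ = 1⟩`, where `γᵢ` is a loop around the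
`i`-th cone point. -/
abbrev Pi1 : Type := PresentedGroup relators

/-- The loop around the `i`-th cone point. -/
def loop (i : Fin 4) : Pi1 := PresentedGroup.of i

/-- `IsSplitting c L R`: a simple closed curve in the class `c` cuts the orbifold into two pieces
with two cone points each, and `L`, `R` are the fundamental groups of the pieces.

For the standard curve, which separates the first two cone points from the last two, we have
`c = γ₀ γ₁`, `L = ⟨γ₀, γ₁⟩` and `R = ⟨γ₂, γ₃⟩`. Any other curve of this kind is the image of the
standard one under a self-homeomorphism of the orbifold (classification of surfaces), so its
class and the two groups are the images of the standard ones under an automorphism `φ` of the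
fundamental group. The choice of base point and connecting paths is absorbed by inner
automorphisms, and swapping the names of the pieces is also realized by a homeomorphism. -/
def IsSplitting (c : Pi1) (L R : Subgroup Pi1) : Prop :=
  ∃ φ : Pi1 ≃* Pi1,
    c = φ (loop 0 * loop 1) ∧
    L = Subgroup.closure {φ (loop 0), φ (loop 1)} ∧
    R = Subgroup.closure {φ (loop 2), φ (loop 3)}

/-! ### The Fuchsian representation `σ` into the triangle group `Δ(3,4,4)` -/

/-- A lift to `SL(2,ℝ)` of the rotation of order `3` generating `Δ(3,4,4)`. -/
def xSL : SL(2, ℝ) := ⟨!![0, -1; 1, 1], by simp [Matrix.det_fin_two]⟩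

/-- A lift to `SL(2,ℝ)` of the rotation of order `4` generating `Δ(3,4,4)`. -/
def ySL : SL(2, ℝ) :=
  ⟨!![0, -1 - √2; -1 + √2, √2], by
    have h : √2 * √2 = (2 : ℝ) := Real.mul_self_sqrt (by norm_num)
    rw [Matrix.det_fin_two_of]
    linear_combination h⟩

/-- The generator `x` of `Δ(3,4,4)`. -/
def x : PSL(2, ℝ) := QuotientGroup.mk xSL

/-- The generator `y` of `Δ(3,4,4)`. -/
def y : PSL(2, ℝ) := QuotientGroup.mk ySL

lemma neg_one_mem_center : (-1 : SL(2, ℝ)) ∈ Subgroup.center SL(2, ℝ) := by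
  rw [Subgroup.mem_center_iff]
  intro g
  simp

lemma sqrt_two_sq : √2 ^ 2 = (2 : ℝ) := Real.sq_sqrt (by norm_num)

lemma x_pow_three : x ^ 3 = 1 := by
  have h : xSL ^ 3 = -1 := by
    apply Subtype.ext
    rw [Matrix.SpecialLinearGroup.coe_pow, Matrix.SpecialLinearGroup.coe_neg]
    ext i j
    fin_cases i <;> fin_cases j <;> simp [xSL, pow_succ]
  rw [x, ← QuotientGroup.mk_pow, QuotientGroup.eq_one_iff, h]
  exact neg_one_mem_center

lemma y_pow_four : y ^ 4 = 1 := by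
  have h2 : ySL.1 * ySL.1 = !![-1, -2 - √2; 2 - √2, 1] := by
    ext i j
    fin_cases i <;> fin_cases j <;> simp [ySL] <;> ring_nf <;>
      (try rw [sqrt_two_sq]) <;> (try ring)
  have h : ySL ^ 4 = -1 := by
    apply Subtype.ext
    rw [Matrix.SpecialLinearGroup.coe_pow, Matrix.SpecialLinearGroup.coe_neg,
      show 4 = 2 + 2 from rfl, pow_add, sq, h2]
    ext i j
    fin_cases i <;> fin_cases j <;> simp <;> ring_nf <;>
      (try rw [sqrt_two_sq]) <;> (try ring)
  rw [y, ← QuotientGroup.mk_pow, QuotientGroup.eq_one_iff, h]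
  exact neg_one_mem_center

lemma xy_pow_four : (x * y) ^ 4 = 1 := by
  have h1 : xSL.1 * ySL.1 = !![1 - √2, -√2; √2 - 1, -1] := by
    ext i j
    fin_cases i <;> fin_cases j <;> simp [xSL, ySL] <;> ring
  have h2 : (xSL.1 * ySL.1) * (xSL.1 * ySL.1) = !![1 - √2, 2; √2 - 2, √2 - 1] := by
    rw [h1]
    ext i j
    fin_cases i <;> fin_cases j <;> simp <;> ring_nf <;>
      (try rw [sqrt_two_sq]) <;> (try ring)
  have h : (xSL * ySL) ^ 4 = -1 := by
    apply Subtype.ext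
    rw [Matrix.SpecialLinearGroup.coe_pow, Matrix.SpecialLinearGroup.coe_neg,
      Matrix.SpecialLinearGroup.coe_mul, show 4 = 2 + 2 from rfl, pow_add, sq, h2]
    ext i j
    fin_cases i <;> fin_cases j <;> simp <;> ring_nf <;>
      (try rw [sqrt_two_sq]) <;> (try ring)
  rw [x, y, ← QuotientGroup.mk_mul, ← QuotientGroup.mk_pow, QuotientGroup.eq_one_iff, h]
  exact neg_one_mem_center

/-- `θ₀ = x` and `θᵢ₊₁ = y θᵢ y⁻¹`. -/
def theta (i : Fin 4) : PSL(2, ℝ) := y ^ (i : ℕ) * x * (y ^ (i : ℕ))⁻¹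

lemma theta_relations : ∀ r ∈ relators, FreeGroup.lift theta r = 1 := by
  rintro r (⟨i, rfl⟩ | rfl)
  · simp [theta, conj_pow, x_pow_three]
  · have e : theta 0 * theta 1 * theta 2 * theta 3 = (x * y) ^ 4 * (y ^ 4)⁻¹ := by
      simp only [theta, Fin.val_zero, Fin.val_one, Fin.val_two, Fin.isValue,
        show ((3 : Fin 4) : ℕ) = 3 from rfl, pow_succ, pow_zero]
      group
    simp [e, xy_pow_four, y_pow_four]

/-- The representation `σ : π₁(O) → Δ(3,4,4) < PSL(2,ℝ)` sending `γᵢ` to `θᵢ`. -/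
def sigma : Pi1 →* PSL(2, ℝ) := PresentedGroup.toGroup theta_relations

/-! ### The irreducible representation `ω` of `PSL(2,ℝ)` in odd dimension -/

/-- Real binary forms of degree `m`; a real vector space of dimension `m + 1`. -/
abbrev BinaryForm (m : ℕ) : Submodule ℝ (MvPolynomial (Fin 2) ℝ) :=
  MvPolynomial.homogeneousSubmodule (Fin 2) ℝ m

/-- The linear substitution `(X₀, X₁) ↦ (X₀, X₁) g` in polynomials. -/
def subst (g : Matrix (Fin 2) (Fin 2) ℝ) : MvPolynomial (Fin 2) ℝ →ₐ[ℝ] MvPolynomial (Fin 2) ℝ :=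
  MvPolynomial.aeval fun j => ∑ i, MvPolynomial.C (g i j) * MvPolynomial.X i

lemma subst_isHomogeneous (g : Matrix (Fin 2) (Fin 2) ℝ) {m : ℕ} {P : MvPolynomial (Fin 2) ℝ}
    (hP : P.IsHomogeneous m) : (subst g P).IsHomogeneous m := by
  have := hP.aeval (fun j => ∑ i, MvPolynomial.C (g i j) * MvPolynomial.X i) (n := 1) fun j =>
    MvPolynomial.IsHomogeneous.sum _ _ _ fun i _ => MvPolynomial.isHomogeneous_C_mul_X _ _
  rwa [one_mul] at this

lemma subst_one : subst 1 = AlgHom.id ℝ _ := by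
  apply MvPolynomial.algHom_ext
  intro j
  fin_cases j <;> simp [subst]

lemma subst_mul (g h : Matrix (Fin 2) (Fin 2) ℝ) : subst (g * h) = (subst g).comp (subst h) := by
  apply MvPolynomial.algHom_ext
  intro j
  simp only [subst, MvPolynomial.aeval_X, AlgHom.comp_apply, Fin.sum_univ_two, Matrix.mul_apply,
    map_add, map_mul, MvPolynomial.algHom_C, MvPolynomial.algebraMap_eq]
  ring

/-- The representation `ω̃` of `SL(2,ℝ)` on binary forms of degree `m` by linear substitution. -/
def omegaTilde (m : ℕ) : Representation ℝ SL(2, ℝ) (BinaryForm m) where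
  toFun g := (subst (g : Matrix (Fin 2) (Fin 2) ℝ)).toLinearMap.restrict
    fun _ hP => subst_isHomogeneous _ hP
  map_one' := by
    ext1 P
    apply Subtype.ext
    simp [LinearMap.restrict_apply, subst_one]
  map_mul' g h := by
    ext1 P
    apply Subtype.ext
    exact congrArg (fun f => f P.1) (subst_mul (g : Matrix (Fin 2) (Fin 2) ℝ) h)

lemma subst_neg_one {m : ℕ} {P : MvPolynomial (Fin 2) ℝ} (hP : P.IsHomogeneous m) :
    subst (-1) P = (-1) ^ m * P := by
  have hX : subst (-1) = MvPolynomial.aeval (fun j => -MvPolynomial.X j) := by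
    apply MvPolynomial.algHom_ext
    intro j
    fin_cases j <;> simp [subst]
  rw [hX]
  conv_lhs => rw [P.as_sum]
  conv_rhs => rw [P.as_sum]
  rw [map_sum, Finset.mul_sum]
  refine Finset.sum_congr rfl fun d hd => ?_
  have hdeg : d 0 + d 1 = m := by
    have := hP (MvPolynomial.mem_support_iff.mp hd)
    simpa [Finsupp.weight_apply, Finsupp.sum_fintype, Fin.sum_univ_two] using this
  rw [MvPolynomial.aeval_monomial, MvPolynomial.monomial_eq]
  simp only [Finsupp.prod_fintype, pow_zero, implies_true, Fin.prod_univ_two,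
    MvPolynomial.algebraMap_eq]
  rw [← hdeg, neg_pow (MvPolynomial.X 0 : MvPolynomial (Fin 2) ℝ),
    neg_pow (MvPolynomial.X 1 : MvPolynomial (Fin 2) ℝ), pow_add]
  ring

lemma center_le_ker_omegaTilde (k : ℕ) :
    Subgroup.center SL(2, ℝ) ≤ (omegaTilde (2 * k)).ker := by
  intro g hg
  obtain ⟨r, hr, hrg⟩ := Matrix.SpecialLinearGroup.mem_center_iff.mp hg
  have hg' : g = 1 ∨ g = -1 := by
    have : r ^ 2 = 1 := by simpa using hr
    rcases sq_eq_one_iff.mp this with h | h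
    · left
      apply Subtype.ext
      rw [← hrg, h]
      simp
    · right
      apply Subtype.ext
      rw [← hrg, h]
      ext i j
      fin_cases i <;> fin_cases j <;> simp
  rw [MonoidHom.mem_ker]
  rcases hg' with rfl | rfl
  · exact map_one _
  · ext1 P
    apply Subtype.ext
    have := subst_neg_one (m := 2 * k) P.2
    simpa [omegaTilde, LinearMap.restrict_apply, pow_mul] using this

/-- The representation `ω` of `PSL(2,ℝ)` on the `(2k+1)`-dimensional space of binary forms of
degree `2k`, induced by `ω̃`. -/
def omega (k : ℕ) : Representation ℝ PSL(2, ℝ) (BinaryForm (2 * k)) :=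
  QuotientGroup.lift (Subgroup.center SL(2, ℝ)) (omegaTilde (2 * k)) (center_le_ker_omegaTilde k)

/-- The representation `ω ∘ σ` of `π₁(O)`, of dimension `2k+1`. -/
def omegaSigma (k : ℕ) : Representation ℝ Pi1 (BinaryForm (2 * k)) :=
  MonoidHom.comp (omega k) sigma

/-! ### Integral representations -/

/-- The action `g · v = ρ(g) v` on `ℝⁿ` of a representation by integral matrices of determinant
one, through `SL(n,ℤ) < SL(n,ℝ)`. -/
def realAction {G : Type*} [Group G] {n : ℕ} (ρ : G →* SL(n, ℤ)) :
    Representation ℝ G (Fin n → ℝ) where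
  toFun g := Matrix.toLin' ((ρ g : Matrix (Fin n) (Fin n) ℤ).map (Int.castRingHom ℝ))
  map_one' := by
    rw [map_one, Matrix.SpecialLinearGroup.coe_one, ← RingHom.mapMatrix_apply, map_one,
      Matrix.toLin'_one]
    rfl
  map_mul' g h := by
    rw [map_mul, Matrix.SpecialLinearGroup.coe_mul, Matrix.map_mul, Matrix.toLin'_mul]
    rfl

/-- The restriction of a representation of `G` to a subgroup `H`. -/
def restrictTo {G : Type*} [Group G] {V : Type*} [AddCommGroup V] [Module ℝ V]
    (τ : Representation ℝ G V) (H : Subgroup G) : Representation ℝ H V :=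
  MonoidHom.comp τ H.subtype

/-- The integral representation `ρ` is conjugate to the `n`-dimensional real representation `τ`:
in a suitable basis of the space of `τ`, the matrix of `τ g` is `ρ g` for every `g`. -/
def IsIntegralConjugate {G : Type*} [Group G] {V : Type*} [AddCommGroup V] [Module ℝ V] {n : ℕ}
    (ρ : G →* SL(n, ℤ)) (τ : Representation ℝ G V) : Prop :=
  ∃ b : Module.Basis (Fin n) ℝ V,
    ∀ g : G, LinearMap.toMatrix b b (τ g) =
      (ρ g : Matrix (Fin n) (Fin n) ℤ).map (Int.castRingHom ℝ)

end Orbifold3333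

end

noncomputable section

namespace Orbifold3333

/-! ### Traces in a group generated by two elements of order three

In the algebra generated by two `2 × 2` matrices `A`, `C` of determinant `1` and trace `-1`, the
quadruple `(p, q, r, s)` stands for `p + q A + r C + s A C`. The multiplication depends only on
`t = tr (A C)`. -/

/-! In a suitable basis `ρ` is the action on binary forms of degree `2k` through the lift `sigmaHat`
of `σ` to `SL(2,ℝ)`. Two facts give the result.

First, two noncommuting elements of order three in `SL(2,ℝ)` act irreducibly on binary forms
(`eq_bot_or_eq_binaryForm`). They are rotations of the hyperbolic plane about different points, so
their commutator is hyperbolic (`two_lt_trace_commutator`). Once the commutator is diagonal, an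
invariant subspace is spanned by monomials, and a rotation spreads one monomial to all of them
(`eq_binaryForm_of_diagonal`).

Second, the two generators of each piece have noncommuting images
(`not_commute_of_closure_eq_range`). If they commuted, one would be redundant; as three loops
generate `π₁(O)`, its whole image would be generated by two elements of order dividing three. Traces
modulo `8` forbid this: all traces of the image are integers, and both `8` and `-4` occur, whereas a
group generated by two elements of trace `-1` with integral trace of the product cannot meet both
classes `0` and `4` (`trace_avoids`). -/

/-- Right multiplication by `A` in the coordinates `1, A, C, A C`. -/
def mulA {R : Type*} [CommRing R] (t : R) : R × R × R × R → R × R × R × R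
  | (p, q, r, s) => (-q + (t - 1) * r + s, p - q - r + t * s, s - r, -r)

/-- Right multiplication by `C` in the coordinates `1, A, C, A C`. -/
def mulC {R : Type*} [CommRing R] : R × R × R × R → R × R × R × R
  | (p, q, r, s) => (-r, -s, p - r, q - s)

/-- The trace in the coordinates `1, A, C, A C`. -/
def coordTrace {R : Type*} [CommRing R] (t : R) : R × R × R × R → R
  | (p, q, r, s) => 2 * p - q - r + t * s

/-- The position of a quadruple modulo `8` in a bit set. -/
def code : ZMod 8 × ZMod 8 × ZMod 8 × ZMod 8 → ℕ
  | (p, q, r, s) => p.val + 8 * q.val + 64 * r.val + 512 * s.val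

/-- Depth-first search for the quadruples reachable under `mulA` and `mulC`. -/
def explore (t : ZMod 8) : ℕ → List (ZMod 8 × ZMod 8 × ZMod 8 × ZMod 8) → ℕ → ℕ
  | 0, _, S => S
  | _, [], S => S
  | n + 1, v :: l, S =>
    if S.testBit (code v) then explore t n l S
    else explore t n (mulA t v :: mulC v :: l) (S ||| (1 <<< code v))

/-- The image modulo `8` of the group generated by `A` and `C`, as a bit set. -/
def reachable (t : ZMod 8) : ℕ := explore t 1200 [(1, 0, 0, 0)] 0

set_option maxRecDepth 100000 in
-- No correctness proof of `explore` is needed: a set containing the start and closed under both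
-- multiplications contains every reachable quadruple, whatever the search did.
theorem reachable_mul : ∀ t p q r s : ZMod 8, (reachable t).testBit (code (p, q, r, s)) = true →
    (reachable t).testBit (code (mulA t (p, q, r, s))) = true ∧
      (reachable t).testBit (code (mulC (p, q, r, s))) = true := by
  decide +kernel

set_option maxRecDepth 100000 in
theorem reachable_one : ∀ t : ZMod 8, (reachable t).testBit (code (1, 0, 0, 0)) = true := by
  decide +kernel

set_option maxRecDepth 100000 in
theorem reachable_trace : ∀ t : ZMod 8,
    (∀ p q r s : ZMod 8, (reachable t).testBit (code (p, q, r, s)) = true →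
      coordTrace t (p, q, r, s) ≠ 0) ∨
    (∀ p q r s : ZMod 8, (reachable t).testBit (code (p, q, r, s)) = true →
      coordTrace t (p, q, r, s) ≠ 4) := by
  decide +kernel

/-- The matrix with coordinates `(p, q, r, s)`. -/
def coordMatrix (A C : Matrix (Fin 2) (Fin 2) ℝ) : ℤ × ℤ × ℤ × ℤ → Matrix (Fin 2) (Fin 2) ℝ
  | (p, q, r, s) => (p : ℝ) • (1 : Matrix (Fin 2) (Fin 2) ℝ) + (q : ℝ) • A + (r : ℝ) • C +
      (s : ℝ) • (A * C)

lemma sq_eq_of_trace {A : Matrix (Fin 2) (Fin 2) ℝ} (hA : A.det = 1) (tA : A.trace = -1) :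
    A * A = -A - 1 := by
  rw [Matrix.det_fin_two] at hA
  rw [Matrix.trace_fin_two] at tA
  have h11 : A 1 1 = -1 - A 0 0 := by linarith
  rw [h11] at hA
  ext i j
  fin_cases i <;> fin_cases j <;>
    simp [Matrix.mul_apply, Fin.sum_univ_two, h11] <;> linarith

section

variable {A C : Matrix (Fin 2) (Fin 2) ℝ}

/-- Polarized Cayley–Hamilton: it rewrites `C A` in the coordinates `1, A, C, A C`. -/
lemma mul_swap_of_trace (tA : A.trace = -1) (tC : C.trace = -1) :
    C * A = -(A * C) - A - C + ((A * C).trace - 1) • (1 : Matrix (Fin 2) (Fin 2) ℝ) := by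
  rw [Matrix.trace_fin_two] at tA tC
  have hA : A 1 1 = -1 - A 0 0 := by linarith
  have hC : C 1 1 = -1 - C 0 0 := by linarith
  ext i j
  fin_cases i <;> fin_cases j <;>
    simp [Matrix.mul_apply, Matrix.trace_fin_two, Fin.sum_univ_two, hA, hC] <;> ring

lemma coordMatrix_mul_right (hC : C.det = 1) (tC : C.trace = -1) (v : ℤ × ℤ × ℤ × ℤ) :
    coordMatrix A C v * C = coordMatrix A C (mulC v) := by
  obtain ⟨p, q, r, s⟩ := v
  have hCC := sq_eq_of_trace hC tC
  simp only [coordMatrix, mulC, add_mul, smul_mul_assoc, mul_assoc, one_mul, hCC, mul_sub, mul_neg,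
    mul_one]
  push_cast
  module

lemma coordMatrix_mul_left (hA : A.det = 1) (tA : A.trace = -1) (tC : C.trace = -1) {t : ℤ}
    (ht : (A * C).trace = t) (v : ℤ × ℤ × ℤ × ℤ) :
    coordMatrix A C v * A = coordMatrix A C (mulA t v) := by
  obtain ⟨p, q, r, s⟩ := v
  have hAA := sq_eq_of_trace hA tA
  have hCA := mul_swap_of_trace tA tC
  have hACA : A * (C * A) = C + 1 + (t : ℝ) • A := by
    rw [hCA, ht, mul_add, mul_sub, mul_sub, mul_neg, ← mul_assoc, hAA, Matrix.mul_smul, mul_one,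
      sub_mul, neg_mul, one_mul]
    module
  simp only [coordMatrix, mulA, add_mul, smul_mul_assoc, mul_assoc, one_mul, hAA, hACA]
  rw [hCA, ht]
  push_cast
  module

lemma trace_coordMatrix (tA : A.trace = -1) (tC : C.trace = -1) {t : ℤ}
    (ht : (A * C).trace = t) (v : ℤ × ℤ × ℤ × ℤ) :
    (coordMatrix A C v).trace = (coordTrace t v : ℤ) := by
  obtain ⟨p, q, r, s⟩ := v
  simp [coordMatrix, coordTrace, Matrix.trace_add, Matrix.trace_smul, tA, tC, ht]
  ring

end

/-- Reduction of coordinates modulo `8`. -/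
def reduce (v : ℤ × ℤ × ℤ × ℤ) : ZMod 8 × ZMod 8 × ZMod 8 × ZMod 8 :=
  (v.1, v.2.1, v.2.2.1, v.2.2.2)

lemma pow_three_eq_one_of_trace {A : SL(2, ℝ)} (tA : A.1.trace = -1) : A ^ 3 = 1 := by
  apply Subtype.ext
  have h := sq_eq_of_trace A.2 tA
  rw [Matrix.SpecialLinearGroup.coe_pow, pow_succ, pow_two, h, sub_mul, neg_mul, h]
  simp

/-- An induction principle for a group generated by two elements of order dividing three. -/
lemma closure_pair_induction {G : Type*} [Group G] {a c : G} (ha : a ^ 3 = 1) (hc : c ^ 3 = 1)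
    {P : G → Prop} (one : P 1) (hPa : ∀ g, P g → P (g * a)) (hPc : ∀ g, P g → P (g * c))
    {g : G} (hg : g ∈ Subgroup.closure {a, c}) : P g := by
  have hinv : ∀ z : G, z ^ 3 = 1 → z⁻¹ = z * z := fun z hz =>
    inv_eq_of_mul_eq_one_left (by rw [← hz, pow_succ, pow_two])
  induction hg using Subgroup.closure_induction_right with
  | one => exact one
  | mul_right x y _ hy hx =>
    rcases hy with rfl | rfl
    exacts [hPa _ hx, hPc _ hx]
  | mul_inv_cancel x y _ hy hx =>
    rcases hy with rfl | rfl
    · rw [hinv _ ha, ← mul_assoc]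
      exact hPa _ (hPa _ hx)
    · rw [hinv _ hc, ← mul_assoc]
      exact hPc _ (hPc _ hx)

/-- The traces of a group generated by two elements of order three with integral trace of the
product cannot meet both the class of `0` and the class of `4` modulo `8`. -/
theorem trace_avoids {A C : SL(2, ℝ)} (tA : A.1.trace = -1) (tC : C.1.trace = -1) {t : ℤ}
    (ht : (A * C).1.trace = t) {g h : SL(2, ℝ)} (hg : g ∈ Subgroup.closure {A, C})
    (hh : h ∈ Subgroup.closure {A, C}) {m n : ℤ} (hgm : g.1.trace = m) (hhn : h.1.trace = n)
    (hm : (m : ZMod 8) = 0) (hn : (n : ZMod 8) = 4) : False := by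
  have ht' : (A.1 * C.1).trace = t := by rw [← ht]; rfl
  -- Integrality of `t` keeps the coordinates integral along any word in `A` and `C`, so they can be
  -- reduced modulo `8`. They need not be unique.
  have key : ∀ g ∈ Subgroup.closure {A, C}, ∃ v : ℤ × ℤ × ℤ × ℤ, g.1 = coordMatrix A.1 C.1 v ∧
      (reachable t).testBit (code (reduce v)) = true := by
    intro g hg
    refine closure_pair_induction (P := fun g : SL(2, ℝ) => ∃ v : ℤ × ℤ × ℤ × ℤ,
      g.1 = coordMatrix A.1 C.1 v ∧ (reachable t).testBit (code (reduce v)) = true)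
      (pow_three_eq_one_of_trace tA) (pow_three_eq_one_of_trace tC) ?_ ?_ ?_ hg
    · refine ⟨(1, 0, 0, 0), by simp [coordMatrix], ?_⟩
      simpa [reduce] using reachable_one t
    · rintro g ⟨v, hv, hr⟩
      refine ⟨mulA t v, ?_, ?_⟩
      · rw [← coordMatrix_mul_left A.2 tA tC ht', ← hv]; rfl
      · have := (reachable_mul _ _ _ _ _ hr).1
        simpa [reduce, mulA] using this
    · rintro g ⟨v, hv, hr⟩
      refine ⟨mulC v, ?_, ?_⟩
      · rw [← coordMatrix_mul_right C.2 tC, ← hv]; rfl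
      · have := (reachable_mul _ _ _ _ _ hr).2
        simpa [reduce, mulC] using this
  have tr : ∀ g ∈ Subgroup.closure {A, C}, ∀ m : ℤ, g.1.trace = m →
      ∃ v, (reachable t).testBit (code v) = true ∧ coordTrace (t : ZMod 8) v = m := by
    intro g hg m hm
    obtain ⟨v, hv, hr⟩ := key g hg
    refine ⟨reduce v, hr, ?_⟩
    rw [hv, trace_coordMatrix tA tC ht'] at hm
    rw [← Int.cast_inj.mp hm]
    simp [coordTrace, reduce]
  obtain ⟨v, hv, hv0⟩ := tr g hg m hgm
  obtain ⟨w, hw, hw4⟩ := tr h hh n hhn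
  rcases reachable_trace t with H | H
  · exact H _ _ _ _ hv (hv0.trans hm)
  · exact H _ _ _ _ hw (hw4.trans hn)

/-! ### The lift of `σ` to `SL(2,ℝ)` -/

lemma loop_pow_three (i : Fin 4) : loop i ^ 3 = 1 :=
  PresentedGroup.one_of_mem (rels := relators) (Or.inl ⟨i, rfl⟩)

lemma loop_prod : loop 0 * loop 1 * loop 2 * loop 3 = 1 :=
  PresentedGroup.one_of_mem (rels := relators) (Or.inr rfl)

lemma closure_range_loop : Subgroup.closure (Set.range loop) = ⊤ :=
  PresentedGroup.closure_range_of relators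

lemma closure_loop_zero_one_two : Subgroup.closure {loop 0, loop 1, loop 2} = ⊤ := by
  rw [eq_top_iff, ← closure_range_loop, Subgroup.closure_le]
  rintro _ ⟨i, rfl⟩
  have h0 : loop 0 ∈ Subgroup.closure {loop 0, loop 1, loop 2} :=
    Subgroup.subset_closure (by simp)
  have h1 : loop 1 ∈ Subgroup.closure {loop 0, loop 1, loop 2} :=
    Subgroup.subset_closure (by simp)
  have h2 : loop 2 ∈ Subgroup.closure {loop 0, loop 1, loop 2} :=
    Subgroup.subset_closure (by simp)
  have h3 : loop 3 ∈ Subgroup.closure {loop 0, loop 1, loop 2} := by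
    rw [← inv_eq_of_mul_eq_one_right loop_prod]
    exact inv_mem (mul_mem (mul_mem h0 h1) h2)
  fin_cases i <;> assumption

lemma closure_loop_two_three_zero : Subgroup.closure {loop 2, loop 3, loop 0} = ⊤ := by
  rw [eq_top_iff, ← closure_range_loop, Subgroup.closure_le]
  rintro _ ⟨i, rfl⟩
  have h0 : loop 0 ∈ Subgroup.closure {loop 2, loop 3, loop 0} :=
    Subgroup.subset_closure (by simp)
  have h2 : loop 2 ∈ Subgroup.closure {loop 2, loop 3, loop 0} :=
    Subgroup.subset_closure (by simp)
  have h3 : loop 3 ∈ Subgroup.closure {loop 2, loop 3, loop 0} :=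
    Subgroup.subset_closure (by simp)
  have h1 : loop 1 ∈ Subgroup.closure {loop 2, loop 3, loop 0} := by
    have : loop 1 = (loop 0)⁻¹ * (loop 2 * loop 3)⁻¹ := by
      have h := loop_prod
      rw [mul_assoc (_ * _)] at h
      rw [← eq_inv_of_mul_eq_one_left h]
      group
    rw [this]
    exact mul_mem (inv_mem h0) (inv_mem (mul_mem h2 h3))
  fin_cases i <;> assumption

/-- The lifts `Yⁱ X Y⁻ⁱ` of `θᵢ`, where `X = -xSL` has order three. -/
def thetaHat (i : Fin 4) : SL(2, ℝ) := ySL ^ (i : ℕ) * (-xSL) * (ySL ^ (i : ℕ))⁻¹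

lemma coe_neg_xSL : (-xSL).1 = !![0, 1; -1, -1] := by
  rw [Matrix.SpecialLinearGroup.coe_neg]
  ext i j
  fin_cases i <;> fin_cases j <;> simp [xSL]

lemma neg_xSL_pow_three : (-xSL) ^ 3 = 1 := by
  apply pow_three_eq_one_of_trace
  rw [coe_neg_xSL, Matrix.trace_fin_two]
  simp

lemma ySL_pow_four : ySL ^ 4 = -1 := by
  have h2 : ySL.1 * ySL.1 = !![-1, -2 - √2; 2 - √2, 1] := by
    ext i j
    fin_cases i <;> fin_cases j <;> simp [ySL] <;> ring_nf <;>
      (try rw [sqrt_two_sq]) <;> (try ring)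
  apply Subtype.ext
  rw [Matrix.SpecialLinearGroup.coe_pow, Matrix.SpecialLinearGroup.coe_neg,
    show 4 = 2 + 2 from rfl, pow_add, sq, h2]
  ext i j
  fin_cases i <;> fin_cases j <;> simp <;> ring_nf <;>
    (try rw [sqrt_two_sq]) <;> (try ring)

lemma neg_xSL_mul_ySL_pow_four : (-xSL * ySL) ^ 4 = -1 := by
  have h1 : (-xSL).1 * ySL.1 = -!![1 - √2, -√2; √2 - 1, -1] := by
    rw [coe_neg_xSL]
    ext i j
    fin_cases i <;> fin_cases j <;> simp [ySL] <;> ring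
  have h2 : ((-xSL).1 * ySL.1) * ((-xSL).1 * ySL.1) = !![1 - √2, 2; √2 - 2, √2 - 1] := by
    rw [h1]
    ext i j
    fin_cases i <;> fin_cases j <;> simp <;> ring_nf <;>
      (try rw [sqrt_two_sq]) <;> (try ring)
  apply Subtype.ext
  rw [Matrix.SpecialLinearGroup.coe_pow, Matrix.SpecialLinearGroup.coe_neg,
    Matrix.SpecialLinearGroup.coe_mul, show 4 = 2 + 2 from rfl, pow_add, sq, h2]
  ext i j
  fin_cases i <;> fin_cases j <;> simp <;> ring_nf <;>
    (try rw [sqrt_two_sq]) <;> (try ring)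

/-- The sign in `-xSL` turns the cube `-1` into `1`. In the long relation the two fourth powers are
both `-1` and cancel. -/
lemma thetaHat_relations : ∀ r ∈ relators, FreeGroup.lift thetaHat r = 1 := by
  rintro r (⟨i, rfl⟩ | rfl)
  · simp only [map_pow, FreeGroup.lift_apply_of, thetaHat, conj_pow, neg_xSL_pow_three]
    group
  · have e : thetaHat 0 * thetaHat 1 * thetaHat 2 * thetaHat 3 =
        (-xSL * ySL) ^ 4 * (ySL ^ 4)⁻¹ := by
      simp only [thetaHat, Fin.val_zero, Fin.val_one, Fin.val_two, Fin.isValue,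
        show ((3 : Fin 4) : ℕ) = 3 from rfl, pow_succ, pow_zero]
      group
    simp only [map_mul, FreeGroup.lift_apply_of]
    rw [e, neg_xSL_mul_ySL_pow_four, ySL_pow_four, mul_inv_cancel]

/-- The lift of `σ` to `SL(2,ℝ)`. -/
def sigmaHat : Pi1 →* SL(2, ℝ) := PresentedGroup.toGroup thetaHat_relations

lemma sigmaHat_loop (i : Fin 4) : sigmaHat (loop i) = thetaHat i :=
  PresentedGroup.toGroup.of thetaHat_relations

lemma mk_sigmaHat (g : Pi1) : (QuotientGroup.mk (sigmaHat g) : PSL(2, ℝ)) = sigma g := by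
  have hx : (QuotientGroup.mk (-xSL) : PSL(2, ℝ)) = x := by
    rw [x, QuotientGroup.eq]
    have : (-xSL)⁻¹ * xSL = -1 := by
      rw [inv_mul_eq_iff_eq_mul]
      simp
    rw [this]
    exact neg_one_mem_center
  have h : (QuotientGroup.mk' (Subgroup.center SL(2, ℝ))).comp sigmaHat = sigma := by
    apply PresentedGroup.ext
    intro i
    change QuotientGroup.mk (sigmaHat (loop i)) = sigma (PresentedGroup.of i)
    rw [sigmaHat_loop, sigma, PresentedGroup.toGroup.of, thetaHat, theta, QuotientGroup.mk_mul,
      QuotientGroup.mk_mul, QuotientGroup.mk_inv, QuotientGroup.mk_pow, hx]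
    rfl
  rw [← h]
  rfl

lemma omegaSigma_eq (k : ℕ) (g : Pi1) : omegaSigma k g = omegaTilde (2 * k) (sigmaHat g) := by
  change omega k (sigma g) = _
  rw [← mk_sigmaHat]
  rfl

lemma thetaHat_zero : (thetaHat 0).1 = !![0, 1; -1, -1] := by
  have : thetaHat 0 = -xSL := by simp [thetaHat]
  rw [this, coe_neg_xSL]

lemma conj_pow_succ_mul {G : Type*} [Group G] (a b : G) (n : ℕ) :
    b ^ (n + 1) * a * (b ^ (n + 1))⁻¹ * b = b * (b ^ n * a * (b ^ n)⁻¹) := by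
  rw [pow_succ']
  group

lemma thetaHat_succ_mul (i : Fin 3) :
    (thetaHat i.succ).1 * ySL.1 = ySL.1 * (thetaHat i.castSucc).1 := by
  rw [← Matrix.SpecialLinearGroup.coe_mul, ← Matrix.SpecialLinearGroup.coe_mul]
  exact congrArg Subtype.val (conj_pow_succ_mul (-xSL) ySL (i : ℕ))

/-- Lets the conjugates by `ySL` be computed from `thetaHat_succ_mul` without inverting a matrix. -/
lemma eq_of_mul_ySL {M N : Matrix (Fin 2) (Fin 2) ℝ} (h : M * ySL.1 = N * ySL.1) : M = N := by
  have := congrArg (· * (ySL⁻¹).1) h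
  simpa only [mul_assoc, ← Matrix.SpecialLinearGroup.coe_mul, mul_inv_cancel,
    Matrix.SpecialLinearGroup.coe_one, mul_one] using this

lemma thetaHat_one : (thetaHat 1).1 = !![1 + √2, 3 + 2 * √2; -3 + √2, -2 - √2] := by
  apply eq_of_mul_ySL
  rw [show (1 : Fin 4) = (0 : Fin 3).succ from rfl, thetaHat_succ_mul,
    show (0 : Fin 3).castSucc = 0 from rfl, thetaHat_zero]
  ext i j
  fin_cases i <;> fin_cases j <;> simp [ySL] <;> ring_nf <;>
      (try rw [sqrt_two_sq]) <;> (try ring)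

lemma thetaHat_two : (thetaHat 2).1 = !![2, 5 + 3 * √2; -5 + 3 * √2, -3] := by
  apply eq_of_mul_ySL
  rw [show (2 : Fin 4) = (1 : Fin 3).succ from rfl, thetaHat_succ_mul,
    show (1 : Fin 3).castSucc = 1 from rfl, thetaHat_one]
  ext i j
  fin_cases i <;> fin_cases j <;> simp [ySL] <;> ring_nf <;>
      (try rw [sqrt_two_sq]) <;> (try ring)

lemma thetaHat_zero_mul_one :
    (thetaHat 0).1 * (thetaHat 1).1 = !![-3 + √2, -2 - √2; 2 - 2 * √2, -1 - √2] := by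
  rw [thetaHat_zero, thetaHat_one]
  ext i j
  fin_cases i <;> fin_cases j <;> simp <;> ring

lemma trace_thetaHat_zero : (thetaHat 0).1.trace = -1 := by
  simp [thetaHat_zero, Matrix.trace_fin_two]

lemma trace_thetaHat_one : (thetaHat 1).1.trace = -1 := by
  rw [thetaHat_one, Matrix.trace_fin_two]
  simp
  ring

lemma trace_thetaHat_zero_mul_one : ((thetaHat 0).1 * (thetaHat 1).1).trace = (-4 : ℤ) := by
  rw [thetaHat_zero_mul_one, Matrix.trace_fin_two]
  simp
  ring

/-- This trace is `0` modulo `8`, while that of `thetaHat 0 * thetaHat 1` is `4`: the pair that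
`trace_avoids` excludes. -/
lemma trace_thetaHat_zero_mul_two_sq :
    (thetaHat 0 * (thetaHat 2 * thetaHat 2)).1.trace = (8 : ℤ) := by
  rw [Matrix.SpecialLinearGroup.coe_mul, Matrix.SpecialLinearGroup.coe_mul, thetaHat_zero,
    thetaHat_two, Matrix.trace_fin_two]
  simp
  linear_combination (-9) * sqrt_two_sq

/-- The entries lie in `ℤ[√2]`, but the third generator is an integral combination of `1, A, C, A C`
for the first two. Hence the `ℤ`-span of these four matrices is stable under the whole image, which
makes all traces integral. -/
lemma thetaHat_two_eq : (thetaHat 2).1 =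
    (-2 : ℝ) • (1 : Matrix (Fin 2) (Fin 2) ℝ) + (thetaHat 1).1 -
      (thetaHat 0).1 * (thetaHat 1).1 := by
  rw [thetaHat_zero_mul_one, thetaHat_one, thetaHat_two]
  ext i j
  fin_cases i <;> fin_cases j <;> simp <;> ring

/-- The group `Δ(3,4,4)` has integral traces on the image of `π₁(O)`. -/
theorem trace_sigmaHat (g : Pi1) : ∃ t : ℤ, (sigmaHat g).1.trace = t := by
  set A := (thetaHat 0).1
  set C := (thetaHat 1).1
  have mulTwo : ∀ v, ∃ w, coordMatrix A C v * (thetaHat 2).1 = coordMatrix A C w := by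
    intro v
    have hA := coordMatrix_mul_left (thetaHat 0).2 trace_thetaHat_zero trace_thetaHat_one
      trace_thetaHat_zero_mul_one
    have hC := coordMatrix_mul_right (A := A) (thetaHat 1).2 trace_thetaHat_one
    -- This is `v (-2 + C - A C)`; the parameter `-4` is the trace of `A C`.
    refine ⟨(-2 : ℤ) • v + mulC v - mulC (mulA (-4) v), ?_⟩
    rw [thetaHat_two_eq, mul_sub, mul_add, ← mul_assoc, hA, hC, hC]
    obtain ⟨p, q, r, s⟩ := v
    simp only [coordMatrix, mulA, mulC, Prod.smul_mk, Prod.mk_add_mk, Prod.mk_sub_mk,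
      Matrix.mul_smul, mul_one]
    push_cast [zsmul_eq_mul]
    module
  have key : ∃ v, (sigmaHat g).1 = coordMatrix A C v := by
    have hg : g ∈ Subgroup.closure {loop 0, loop 1, loop 2} := by
      rw [closure_loop_zero_one_two]; trivial
    have step : ∀ z ∈ ({loop 0, loop 1, loop 2} : Set Pi1), ∀ x : Pi1,
        (∃ v, (sigmaHat x).1 = coordMatrix A C v) →
        ∃ v, (sigmaHat (x * z)).1 = coordMatrix A C v := by
      rintro z hz x ⟨v, hv⟩
      simp only [map_mul, Matrix.SpecialLinearGroup.coe_mul, hv]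
      rcases hz with rfl | rfl | rfl
      · rw [sigmaHat_loop]
        exact ⟨_, coordMatrix_mul_left (thetaHat 0).2 trace_thetaHat_zero trace_thetaHat_one
          trace_thetaHat_zero_mul_one v⟩
      · rw [sigmaHat_loop]
        exact ⟨_, coordMatrix_mul_right (thetaHat 1).2 trace_thetaHat_one v⟩
      · rw [sigmaHat_loop]
        exact mulTwo v
    have hinv : ∀ z ∈ ({loop 0, loop 1, loop 2} : Set Pi1), z⁻¹ = z * z := by
      rintro z hz
      have : z ^ 3 = 1 := by rcases hz with rfl | rfl | rfl <;> exact loop_pow_three _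
      exact inv_eq_of_mul_eq_one_left (by rw [← this, pow_succ, pow_two])
    induction hg using Subgroup.closure_induction_right with
    | one => exact ⟨(1, 0, 0, 0), by simp [coordMatrix]⟩
    | mul_right x y _ hy hx => exact step _ hy _ hx
    | mul_inv_cancel x y _ hy hx =>
      rw [hinv _ hy, ← mul_assoc]
      exact step _ hy _ (step _ hy _ hx)
  obtain ⟨v, hv⟩ := key
  exact ⟨_, by rw [hv, trace_coordMatrix trace_thetaHat_zero trace_thetaHat_one
    trace_thetaHat_zero_mul_one]⟩

/-- The image of `π₁(O)` is not generated by two elements of trace `-1`. -/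
theorem range_sigmaHat_ne_closure {A C : SL(2, ℝ)} (tA : A.1.trace = -1) (tC : C.1.trace = -1) :
    sigmaHat.range ≠ Subgroup.closure {A, C} := by
  intro h
  -- As `A C` lies in the image, its trace is an integer, as `trace_avoids` requires.
  have hAC : A * C ∈ sigmaHat.range := by
    rw [h]
    exact mul_mem (Subgroup.subset_closure (by simp)) (Subgroup.subset_closure (by simp))
  obtain ⟨z, hz⟩ := hAC
  obtain ⟨t, ht⟩ := trace_sigmaHat z
  rw [hz] at ht
  refine trace_avoids tA tC ht (g := sigmaHat (loop 0 * (loop 2 * loop 2)))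
    (h := sigmaHat (loop 0 * loop 1)) (h ▸ ⟨_, rfl⟩) (h ▸ ⟨_, rfl⟩) (m := 8) (n := -4) ?_ ?_
    (by decide) (by decide)
  · simp only [map_mul, sigmaHat_loop]
    exact trace_thetaHat_zero_mul_two_sq
  · simp only [map_mul, sigmaHat_loop]
    exact trace_thetaHat_zero_mul_one

/-! ### Invariant subspaces of binary forms -/

/-- Applying `T - μ a` kills the component at `a` and rescales the others by nonzero factors, which
allows induction on the number of components. -/
lemma mem_of_sum_mem_of_eigenvectors {K V ι : Type*} [Field K] [AddCommGroup V] [Module K V]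
    {T : Module.End K V} {W : Submodule K V} (hW : ∀ w ∈ W, T w ∈ W) (s : Finset ι) {μ : ι → K}
    (hμ : Set.InjOn μ s) {v : ι → V} (hv : ∀ i ∈ s, T (v i) = μ i • v i)
    (hsum : ∑ i ∈ s, v i ∈ W) : ∀ i ∈ s, v i ∈ W := by
  classical
  induction s using Finset.induction_on generalizing v with
  | empty => simp
  | insert a s ha ih =>
    have hs : ∀ i ∈ s, v i ∈ W := by
      have hmem : ∑ i ∈ s, (μ i - μ a) • v i ∈ W := by
        have h := W.sub_mem (hW _ hsum) (W.smul_mem (μ a) hsum)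
        rw [map_sum, Finset.smul_sum, ← Finset.sum_sub_distrib, Finset.sum_insert ha,
          hv a (by simp), sub_self, zero_add] at h
        convert h using 2 with i hi
        rw [hv i (by simp [hi]), sub_smul]
      intro i hi
      have h := ih (hμ.mono (by simp)) (v := fun i => (μ i - μ a) • v i)
        (fun j hj => by rw [map_smul, hv j (by simp [hj]), smul_comm]) hmem i hi
      have hne : μ i - μ a ≠ 0 := by
        rw [sub_ne_zero]
        intro e
        exact ha (hμ (by simp [hi]) (by simp) e ▸ hi)
      exact (W.smul_mem_iff hne).mp h
    intro i hi
    rcases Finset.mem_insert.mp hi with rfl | hi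
    · rw [Finset.sum_insert ha] at hsum
      exact (W.add_mem_iff_left (W.sum_mem hs)).mp hsum
    · exact hs i hi

lemma weight_injective {l : ℝ} (hl : 1 < l) {a b a' b' : ℕ} (h : a + b = a' + b')
    (e : l ^ a * l⁻¹ ^ b = l ^ a' * l⁻¹ ^ b') : a = a' := by
  have h0 : l ≠ 0 := by positivity
  have key : ∀ a b : ℕ, l ^ a * l⁻¹ ^ b * l ^ (a + b) = l ^ (2 * a) := by
    intro a b
    rw [inv_pow, two_mul, pow_add, pow_add]
    field_simp
  have h2 : l ^ (2 * a) = l ^ (2 * a') := by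
    rw [← key a b, ← key a' b', e, h]
  have := (pow_right_injective₀ (by positivity) hl.ne') h2
  omega

lemma subst_X (M : Matrix (Fin 2) (Fin 2) ℝ) (j : Fin 2) :
    subst M (MvPolynomial.X j) = MvPolynomial.C (M 0 j) * MvPolynomial.X 0 +
      MvPolynomial.C (M 1 j) * MvPolynomial.X 1 := by
  simp [subst]

/-- On forms of degree `m`, evaluation at `(1, 0)` reads off the coefficient of `X₀ ^ m`. -/
lemma eval_subst (M : Matrix (Fin 2) (Fin 2) ℝ) (P : MvPolynomial (Fin 2) ℝ) :
    MvPolynomial.eval ![1, 0] (subst M P) = MvPolynomial.eval (M 0) P := by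
  rw [← MvPolynomial.coe_aeval_eq_eval, ← MvPolynomial.coe_aeval_eq_eval]
  change ((MvPolynomial.aeval ![(1 : ℝ), 0]).comp (subst M)) P = MvPolynomial.aeval (M 0) P
  congr 1
  apply MvPolynomial.algHom_ext
  intro j
  simp [subst_X]

lemma subst_diagonal_X_pow (l : ℝ) (a b : ℕ) :
    subst (Matrix.diagonal ![l, l⁻¹]) (MvPolynomial.X 0 ^ a * MvPolynomial.X 1 ^ b) =
      (l ^ a * l⁻¹ ^ b) • (MvPolynomial.X 0 ^ a * MvPolynomial.X 1 ^ b) := by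
  simp only [map_mul, map_pow, subst_X, MvPolynomial.smul_eq_C_mul]
  simp [mul_pow]
  ring

lemma monomial_fin_two (d : Fin 2 →₀ ℕ) (c : ℝ) : MvPolynomial.monomial d c =
    c • (MvPolynomial.X 0 ^ d 0 * MvPolynomial.X 1 ^ d 1 : MvPolynomial (Fin 2) ℝ) := by
  rw [MvPolynomial.monomial_eq, MvPolynomial.smul_eq_C_mul, Finsupp.prod_fintype _ _ (by simp),
    Fin.prod_univ_two]

lemma degree_of_mem_support {m : ℕ} {P : MvPolynomial (Fin 2) ℝ} (hP : P.IsHomogeneous m)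
    {d : Fin 2 →₀ ℕ} (hd : d ∈ P.support) : d 0 + d 1 = m := by
  have := hP (MvPolynomial.mem_support_iff.mp hd)
  simpa [Finsupp.weight_apply, Finsupp.sum_fintype, Fin.sum_univ_two] using this

/-- A space of binary forms stable under a hyperbolic diagonal matrix contains the monomials of
its members. -/
lemma X_pow_mem_of_mem_support {m : ℕ} {W : Submodule ℝ (MvPolynomial (Fin 2) ℝ)}
    (hW : W ≤ BinaryForm m) {l : ℝ} (hl : 1 < l)
    (hD : ∀ P ∈ W, subst (Matrix.diagonal ![l, l⁻¹]) P ∈ W) {P : MvPolynomial (Fin 2) ℝ}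
    (hP : P ∈ W) {d : Fin 2 →₀ ℕ} (hd : d ∈ P.support) :
    MvPolynomial.X 0 ^ d 0 * MvPolynomial.X 1 ^ d 1 ∈ W := by
  have hdeg : ∀ d ∈ P.support, d 0 + d 1 = m := fun d hd =>
    degree_of_mem_support (hW hP) hd
  have h := mem_of_sum_mem_of_eigenvectors
    (T := (subst (Matrix.diagonal ![l, l⁻¹])).toLinearMap) hD P.support
    (μ := fun d => l ^ d 0 * l⁻¹ ^ d 1)
    (v := fun d => MvPolynomial.monomial d (P.coeff d)) ?_ ?_ ?_ d hd
  · rw [monomial_fin_two] at h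
    have hc := MvPolynomial.mem_support_iff.mp hd
    exact (W.smul_mem_iff hc).mp h
  · intro d hd d' hd' e
    have h1 := hdeg d hd
    have h2 := hdeg d' hd'
    have h0 := weight_injective hl (h1.trans h2.symm) e
    ext i
    fin_cases i
    · exact h0
    · simp only [Fin.mk_one]
      omega
  · intro d _
    rw [AlgHom.toLinearMap_apply, monomial_fin_two, map_smul, subst_diagonal_X_pow, smul_comm]
  · rwa [← P.as_sum]

/-- The weights of the diagonal matrix are distinct, so `W` contains some monomial `X₀ ^ a X₁ ^ b`.
Its image under `A` has `X₀ ^ m`-coefficient `A₀₀ ^ a A₀₁ ^ b ≠ 0`, so `X₀ ^ m` is in `W`. The image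
`(A₀₀ X₀ + A₁₀ X₁) ^ m` of the latter involves every monomial. -/
theorem eq_binaryForm_of_diagonal {m : ℕ} {W : Submodule ℝ (MvPolynomial (Fin 2) ℝ)}
    (hW : W ≤ BinaryForm m) {l : ℝ} (hl : 1 < l)
    (hD : ∀ P ∈ W, subst (Matrix.diagonal ![l, l⁻¹]) P ∈ W)
    {A : Matrix (Fin 2) (Fin 2) ℝ} (h00 : A 0 0 ≠ 0) (h01 : A 0 1 ≠ 0) (h10 : A 1 0 ≠ 0)
    (hA : ∀ P ∈ W, subst A P ∈ W) (hne : W ≠ ⊥) : W = BinaryForm m := by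
  obtain ⟨P, hP, hP0⟩ := W.ne_bot_iff.mp hne
  obtain ⟨d, hd⟩ := MvPolynomial.support_nonempty.mpr hP0
  have hX := hA _ (X_pow_mem_of_mem_support hW hl hD hP hd)
  have hev : MvPolynomial.eval ![1, 0]
      (subst A (MvPolynomial.X 0 ^ d 0 * MvPolynomial.X 1 ^ d 1)) ≠ 0 := by
    rw [eval_subst]
    simp [h00, h01]
  obtain ⟨e, he, he1⟩ : ∃ e ∈ (subst A (MvPolynomial.X 0 ^ d 0 * MvPolynomial.X 1 ^ d 1)).support,
      e 1 = 0 := by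
    by_contra! H
    apply hev
    rw [MvPolynomial.eval_eq']
    refine Finset.sum_eq_zero fun e he => ?_
    simp [Fin.prod_univ_two, H e he]
  have hXm : (MvPolynomial.X 0 : MvPolynomial (Fin 2) ℝ) ^ m ∈ W := by
    have h := X_pow_mem_of_mem_support hW hl hD hX he
    have h' := degree_of_mem_support (hW hX) he
    rw [he1, add_zero] at h'
    simpa [he1, h'] using h
  have hmon : ∀ i ∈ Finset.range (m + 1), (MvPolynomial.X 0 ^ i * MvPolynomial.X 1 ^ (m - i) :
      MvPolynomial (Fin 2) ℝ) ∈ W := by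
    intro i hi
    have hsum := hA _ hXm
    rw [map_pow, subst_X, add_pow] at hsum
    have hterm : ∀ i, (MvPolynomial.C (A 0 0) * MvPolynomial.X 0) ^ i *
        (MvPolynomial.C (A 1 0) * MvPolynomial.X 1) ^ (m - i) *
          ((m.choose i : ℕ) : MvPolynomial (Fin 2) ℝ) =
        (A 0 0 ^ i * A 1 0 ^ (m - i) * m.choose i) •
          (MvPolynomial.X 0 ^ i * MvPolynomial.X 1 ^ (m - i)) := by
      intro i
      rw [MvPolynomial.smul_eq_C_mul]
      simp only [map_mul, map_pow, map_natCast, mul_pow]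
      ring
    simp only [hterm] at hsum
    have h := mem_of_sum_mem_of_eigenvectors
      (T := (subst (Matrix.diagonal ![l, l⁻¹])).toLinearMap) hD (Finset.range (m + 1))
      (μ := fun i => l ^ i * l⁻¹ ^ (m - i)) ?_ ?_ hsum i hi
    · have hc : A 0 0 ^ i * A 1 0 ^ (m - i) * (m.choose i : ℝ) ≠ 0 := by
        have : m.choose i ≠ 0 := (Nat.choose_pos (by simpa [Nat.lt_succ_iff] using hi)).ne'
        positivity
      exact (W.smul_mem_iff hc).mp h
    · intro i hi j hj e
      simp only [Finset.coe_range, Set.mem_Iio] at hi hj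
      exact weight_injective hl (by omega) e
    · intro i _
      rw [AlgHom.toLinearMap_apply, map_smul, subst_diagonal_X_pow, smul_comm]
  refine le_antisymm hW fun Q hQ => ?_
  rw [Q.as_sum]
  refine W.sum_mem fun f hf => ?_
  have hdeg := degree_of_mem_support hQ hf
  rw [monomial_fin_two]
  have := hmon (f 0) (by simp; omega)
  rw [show m - f 0 = f 1 by omega] at this
  exact W.smul_mem _ this

/-! ### Two noncommuting elements of order three act irreducibly -/

/-- For `2 × 2` matrices `det (M - N) = det M + det N - tr (M adj N)`; take `M = A B` and `N = B A`.
-/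
lemma trace_commutator (A B : SL(2, ℝ)) :
    (A * B * A⁻¹ * B⁻¹).1.trace = 2 - (A.1 * B.1 - B.1 * A.1).det := by
  have hA := A.2
  have hB := B.2
  rw [Matrix.det_fin_two] at hA hB
  have key : (A * B * A⁻¹ * B⁻¹).1.trace =
      2 * (A.1 0 0 * A.1 1 1 - A.1 0 1 * A.1 1 0) * (B.1 0 0 * B.1 1 1 - B.1 0 1 * B.1 1 0) -
        (A.1 * B.1 - B.1 * A.1).det := by
    simp only [Matrix.SpecialLinearGroup.coe_mul, Matrix.SpecialLinearGroup.coe_inv,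
      Matrix.adjugate_fin_two, Matrix.trace_fin_two, Matrix.det_fin_two, Matrix.mul_apply,
      Fin.sum_univ_two, Matrix.sub_apply, Matrix.of_apply, Matrix.cons_val', Matrix.cons_val_zero,
      Matrix.cons_val_one, Matrix.cons_val_fin_one]
    ring
  rw [key, hA, hB]
  ring

/-- A triangular matrix would have real eigenvalues, but `z² + z + 1` has no real root. -/
lemma offDiag_ne_zero {A : Matrix (Fin 2) (Fin 2) ℝ} (hA : A.det = 1) (tA : A.trace = -1) :
    A 0 1 ≠ 0 ∧ A 1 0 ≠ 0 := by
  rw [Matrix.det_fin_two] at hA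
  rw [Matrix.trace_fin_two] at tA
  have h11 : A 1 1 = -1 - A 0 0 := by linarith
  rw [h11] at hA
  constructor <;> intro h <;> rw [h] at hA <;> nlinarith [sq_nonneg (A 0 0 + 1 / 2)]

/-- `K = A B - B A` is traceless with `tr (A K) = 0`. On traceless matrices `-det` has signature
`(2, 1)`, and the traceless part of the elliptic `A` is a negative vector, so `-det` is positive
definite on its orthogonal complement. Thus `det K < 0` unless `K = 0`. -/
lemma two_lt_trace_commutator {A B : SL(2, ℝ)} (tA : A.1.trace = -1) (tB : B.1.trace = -1)
    (hAB : A * B ≠ B * A) : 2 < (A * B * A⁻¹ * B⁻¹).1.trace := by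
  rw [trace_commutator]
  by_contra! H
  apply hAB
  apply Subtype.ext
  rw [Matrix.SpecialLinearGroup.coe_mul, Matrix.SpecialLinearGroup.coe_mul, ← sub_eq_zero]
  have hb := (offDiag_ne_zero A.2 tA).1
  have hA := A.2
  rw [Matrix.det_fin_two] at hA
  rw [Matrix.trace_fin_two] at tA tB
  set a := A.1 0 0
  set b := A.1 0 1
  set c := A.1 1 0
  have hA1 : A.1 1 1 = -1 - a := by linarith
  set p := B.1 0 0
  set q := B.1 0 1
  set r := B.1 1 0
  have hB1 : B.1 1 1 = -1 - p := by linarith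
  rw [hA1] at hA
  have hK : A.1 * B.1 - B.1 * A.1 =
      !![b * r - q * c, q * (2 * a + 1) - b * (2 * p + 1);
        c * (2 * p + 1) - r * (2 * a + 1), -(b * r - q * c)] := by
    ext i j
    fin_cases i <;> fin_cases j <;>
      simp [Matrix.mul_apply, Fin.sum_univ_two, hA1, hB1] <;> ring
  rw [hK, Matrix.det_fin_two_of] at H
  -- This is `tr (A K) = 0`.
  have hrel : (2 * a + 1) * (b * r - q * c) + b * (c * (2 * p + 1) - r * (2 * a + 1)) +
      c * (q * (2 * a + 1) - b * (2 * p + 1)) = 0 := by ring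
  rw [hK]
  generalize b * r - q * c = k₁ at *
  generalize q * (2 * a + 1) - b * (2 * p + 1) = k₂ at *
  generalize c * (2 * p + 1) - r * (2 * a + 1) = k₃ at *
  -- Completing the square after eliminating `k₃`, with `-b c = (a + 1/2)² + 3/4` from `det A = 1`.
  have hid : b ^ 2 * (k₁ ^ 2 + k₂ * k₃) = (b * k₁ - (a + 1 / 2) * k₂) ^ 2 + 3 / 4 * k₂ ^ 2 := by
    linear_combination (b * k₂) * hrel + k₂ ^ 2 * hA
  have hle : b ^ 2 * (k₁ ^ 2 + k₂ * k₃) ≤ 0 :=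
    mul_nonpos_of_nonneg_of_nonpos (sq_nonneg b) (by nlinarith)
  have h2 : k₂ = 0 := by
    have : k₂ ^ 2 ≤ 0 := by nlinarith [sq_nonneg (b * k₁ - (a + 1 / 2) * k₂)]
    exact pow_eq_zero_iff two_ne_zero |>.mp (le_antisymm this (sq_nonneg _))
  have h1 : k₁ = 0 := by
    rw [h2] at hid hle
    have : (b * k₁) ^ 2 = 0 := le_antisymm (by nlinarith) (sq_nonneg _)
    simpa [hb] using this
  have h3 : k₃ = 0 := by
    rw [h1, h2] at hrel
    simpa [hb] using hrel
  rw [h1, h2, h3]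
  ext i j
  fin_cases i <;> fin_cases j <;> simp

/-- A hyperbolic matrix is diagonalizable. -/
lemma exists_diagonalization {g : Matrix (Fin 2) (Fin 2) ℝ} (hg : g.det = 1) (tg : 2 < g.trace) :
    ∃ (l : ℝ) (h : Matrix (Fin 2) (Fin 2) ℝ), 1 < l ∧ h.det ≠ 0 ∧
      Matrix.diagonal ![l, l⁻¹] * h = h * g := by
  set T := g.trace
  set l := (T + √(T ^ 2 - 4)) / 2
  have hs : √(T ^ 2 - 4) ^ 2 = T ^ 2 - 4 := Real.sq_sqrt (by nlinarith)
  have hl : 1 < l := by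
    have := Real.sqrt_nonneg (T ^ 2 - 4)
    simp only [l]
    linarith
  have hl0 : l ≠ 0 := by positivity
  have hchar : l ^ 2 - T * l + 1 = 0 := by
    simp only [l]
    linear_combination hs / 4
  have hchar' : l⁻¹ ^ 2 - T * l⁻¹ + 1 = 0 := by
    field_simp
    linear_combination hchar
  have hdet : ∀ z : ℝ, z ^ 2 - T * z + 1 = 0 →
      ∃ v : Fin 2 → ℝ, v ≠ 0 ∧ Matrix.vecMul v g = z • v := by
    intro z hz
    have : (g - z • (1 : Matrix (Fin 2) (Fin 2) ℝ)).det = 0 := by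
      rw [Matrix.det_fin_two] at hg ⊢
      simp only [T, Matrix.trace_fin_two] at hz
      simp
      linear_combination hz + hg
    obtain ⟨v, hv0, hv⟩ := Matrix.exists_vecMul_eq_zero_iff.mpr this
    refine ⟨v, hv0, ?_⟩
    rwa [Matrix.vecMul_sub, Matrix.vecMul_smul, Matrix.vecMul_one, sub_eq_zero] at hv
  -- Left eigenvectors are used because they become the rows of the conjugating matrix.
  obtain ⟨v, hv0, hv⟩ := hdet _ hchar
  obtain ⟨w, hw0, hw⟩ := hdet _ hchar'
  have hrow : Matrix.diagonal ![l, l⁻¹] * Matrix.of ![v, w] = Matrix.of ![v, w] * g := by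
    ext i j
    rw [Matrix.diagonal_mul]
    fin_cases i
    · exact (congrFun hv j).symm
    · exact (congrFun hw j).symm
  refine ⟨l, Matrix.of ![v, w], hl, ?_, hrow⟩
  intro h0
  obtain ⟨u, hu0, hu⟩ := Matrix.exists_vecMul_eq_zero_iff.mpr h0
  have e1 : u 0 • v + u 1 • w = 0 := by
    rw [← hu]
    ext j
    simp [Matrix.vecMul, dotProduct, Fin.sum_univ_two]
  have e2 : (u 0 * l) • v + (u 1 * l⁻¹) • w = 0 := by
    have := congrArg (fun z => Matrix.vecMul z g) e1
    simpa [Matrix.add_vecMul, Matrix.smul_vecMul, hv, hw, smul_smul] using this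
  have hll : l⁻¹ < 1 := inv_lt_one_of_one_lt₀ hl
  have hne : l - l⁻¹ ≠ 0 := by linarith
  apply hu0
  have u0 : u 0 = 0 := by
    have : (u 0 * (l - l⁻¹)) • v = 0 := by
      calc (u 0 * (l - l⁻¹)) • v =
          ((u 0 * l) • v + (u 1 * l⁻¹) • w) - l⁻¹ • (u 0 • v + u 1 • w) := by module
        _ = 0 := by rw [e1, e2, smul_zero, sub_zero]
    simpa [hne, hv0] using this
  have u1 : u 1 = 0 := by
    rw [u0] at e1
    simpa [hw0] using e1
  ext i
  fin_cases i
  · exact u0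
  · exact u1

theorem eq_bot_or_eq_binaryForm {m : ℕ} {W : Submodule ℝ (MvPolynomial (Fin 2) ℝ)}
    (hW : W ≤ BinaryForm m) {A B : SL(2, ℝ)} (tA : A.1.trace = -1) (tB : B.1.trace = -1)
    (hAB : A * B ≠ B * A) (hA : ∀ P ∈ W, subst A.1 P ∈ W) (hB : ∀ P ∈ W, subst B.1 P ∈ W) :
    W = ⊥ ∨ W = BinaryForm m := by
  rw [or_iff_not_imp_left]
  intro hne
  have hmul : ∀ {M N : Matrix (Fin 2) (Fin 2) ℝ}, (∀ P ∈ W, subst M P ∈ W) →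
      (∀ P ∈ W, subst N P ∈ W) → ∀ P ∈ W, subst (M * N) P ∈ W := by
    intro M N hM hN P hP
    rw [subst_mul]
    exact hM _ (hN _ hP)
  have hinv : ∀ {C : SL(2, ℝ)}, C.1.trace = -1 → (∀ P ∈ W, subst C.1 P ∈ W) →
      ∀ P ∈ W, subst (C⁻¹).1 P ∈ W := by
    intro C tC hC
    have h3 := pow_three_eq_one_of_trace tC
    rw [inv_eq_of_mul_eq_one_left (show C * C * C = 1 by rw [← h3, pow_succ, pow_two])]
    exact hmul hC hC
  have hg : ∀ P ∈ W, subst (A * B * A⁻¹ * B⁻¹).1 P ∈ W :=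
    hmul (hmul (hmul hA hB) (hinv tA hA)) (hinv tB hB)
  obtain ⟨l, h, hl, hdet, hdiag⟩ := exists_diagonalization (A * B * A⁻¹ * B⁻¹).2
    (two_lt_trace_commutator tA tB hAB)
  have hu : IsUnit h.det := hdet.isUnit
  have hh : h⁻¹ * h = 1 := Matrix.nonsing_inv_mul _ hu
  have hh' : h * h⁻¹ = 1 := Matrix.mul_nonsing_inv _ hu
  have hcancel : ∀ P, subst h⁻¹ (subst h P) = P := by
    intro P
    rw [← AlgHom.comp_apply, ← subst_mul, hh, subst_one, AlgHom.id_apply]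
  -- The space is transported to coordinates in which the commutator is diagonal.
  set W' := W.map (subst h).toLinearMap
  have hconj : ∀ {M N : Matrix (Fin 2) (Fin 2) ℝ}, N * h = h * M → (∀ P ∈ W, subst M P ∈ W) →
      ∀ P ∈ W', subst N P ∈ W' := by
    rintro M N hMN hM _ ⟨P, hP, rfl⟩
    refine ⟨_, hM P hP, ?_⟩
    simp only [AlgHom.toLinearMap_apply, ← AlgHom.comp_apply, ← subst_mul, hMN]
  have hW' : W' ≤ BinaryForm m := by
    rintro _ ⟨P, hP, rfl⟩
    exact subst_isHomogeneous h (hW hP)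
  have hne' : W' ≠ ⊥ := by
    obtain ⟨P, hP, hP0⟩ := W.ne_bot_iff.mp hne
    refine W'.ne_bot_iff.mpr ⟨subst h P, ⟨P, hP, rfl⟩, fun e => hP0 ?_⟩
    rw [← hcancel P, e, map_zero]
  have hA' : ∀ P ∈ W', subst (h * A.1 * h⁻¹) P ∈ W' :=
    hconj (by rw [mul_assoc, hh, mul_one]) hA
  set A' := h * A.1 * h⁻¹
  have dA' : A'.det = 1 := by
    rw [Matrix.det_mul, Matrix.det_mul, A.2, mul_one, ← Matrix.det_mul, hh', Matrix.det_one]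
  have tA' : A'.trace = -1 := by
    rw [Matrix.trace_mul_cycle, hh, one_mul, tA]
  have hAA : A' * A' = -A' - 1 := sq_eq_of_trace dA' tA'
  obtain ⟨h01, h10⟩ := offDiag_ne_zero dA' tA'
  have hfull : W' = BinaryForm m := by
    -- If this entry vanishes, `A'² = -A' - 1` serves instead: its corner entry is `-1` and its
    -- off-diagonal entries are still nonzero.
    by_cases h00 : A' 0 0 = 0
    · have hA'' : ∀ P ∈ W', subst (A' * A') P ∈ W' := by
        intro P hP
        rw [subst_mul]
        exact hA' _ (hA' _ hP)
      rw [hAA] at hA''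
      exact eq_binaryForm_of_diagonal hW' hl (hconj hdiag hg) (by simp [h00]) (by simpa using h01)
        (by simpa using h10) hA'' hne'
    · exact eq_binaryForm_of_diagonal hW' hl (hconj hdiag hg) h00 h01 h10 hA' hne'
  refine le_antisymm hW fun P hP => ?_
  have : subst h P ∈ W' := by
    rw [hfull]
    exact subst_isHomogeneous h hP
  obtain ⟨Q, hQ, hQP⟩ := this
  have e := congrArg (subst h⁻¹) hQP
  rw [AlgHom.toLinearMap_apply, hcancel, hcancel] at e
  rwa [← e]

/-! ### The two pieces of a splitting have noncommuting generators -/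

/-- With `T = tr A`, Cayley–Hamilton turns `A³ = 1` into `(T² - 1) A = T + 1`. If `T ≠ -1` then `A`
is scalar, and taking traces forces `T = 2`. -/
lemma eq_one_or_trace_of_pow_three {A : SL(2, ℝ)} (h : A ^ 3 = 1) : A = 1 ∨ A.1.trace = -1 := by
  have h2 : A.1 * A.1 = A.1.trace • A.1 - 1 := by
    have hA := A.2
    rw [Matrix.det_fin_two] at hA
    ext i j
    fin_cases i <;> fin_cases j <;>
      simp [Matrix.mul_apply, Fin.sum_univ_two, Matrix.trace_fin_two] <;> linarith
  have h3 : A.1 * A.1 * A.1 = 1 := by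
    have := congrArg Subtype.val h
    rwa [Matrix.SpecialLinearGroup.coe_pow, pow_succ, pow_two] at this
  set T := A.1.trace with hT
  have h4 : (T ^ 2 - 1) • A.1 = (T + 1) • (1 : Matrix (Fin 2) (Fin 2) ℝ) := by
    rw [h2, sub_mul, smul_mul_assoc, h2, one_mul] at h3
    calc (T ^ 2 - 1) • A.1 = T • (T • A.1 - 1) - A.1 + T • 1 := by module
      _ = _ := by rw [h3]; module
  by_cases hT1 : T = -1
  · exact Or.inr hT1
  left
  have hT1' : T + 1 ≠ 0 := fun h => hT1 (by linarith)
  have h5 : (T - 1) • A.1 = 1 := by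
    have : (T + 1) • ((T - 1) • A.1) = (T + 1) • (1 : Matrix (Fin 2) (Fin 2) ℝ) := by
      rw [← h4, smul_smul]
      congr 1
      ring
    exact smul_right_injective _ hT1' this
  have h6 : (T - 1) * T = 2 := by
    have := congrArg Matrix.trace h5
    simpa [Matrix.trace_smul, ← hT] using this
  have h7 : T = 2 := by
    have : (T + 1) * (T - 2) = 0 := by linear_combination h6
    rcases mul_eq_zero.mp this with h | h
    · exact absurd h hT1'
    · linarith
  apply Subtype.ext
  rw [h7] at h5
  norm_num at h5
  simpa using h5

/-- Commuting makes the traceless parts proportional: `B + 1/2 = z (A + 1/2)`. Both have square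
`-3/4`, so `z = ±1`, and `z = -1` gives `B = -A - 1 = A²`. -/
lemma eq_or_eq_mul_self_of_commute {A B : SL(2, ℝ)} (tA : A.1.trace = -1) (tB : B.1.trace = -1)
    (h : A * B = B * A) : B = A ∨ B = A * A := by
  have hAA := sq_eq_of_trace A.2 tA
  have hb := (offDiag_ne_zero A.2 tA).1
  have hA := A.2
  have hB := B.2
  have hK : A.1 * B.1 = B.1 * A.1 := congrArg Subtype.val h
  rw [Matrix.det_fin_two] at hA hB
  rw [Matrix.trace_fin_two] at tA tB
  have hA1 : A.1 1 1 = -1 - A.1 0 0 := by linarith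
  have hB1 : B.1 1 1 = -1 - B.1 0 0 := by linarith
  have e00 := congrFun (congrFun hK 0) 0
  have e01 := congrFun (congrFun hK 0) 1
  simp only [Matrix.mul_apply, Fin.sum_univ_two, hA1, hB1] at e00 e01
  rw [hA1] at hA
  rw [hB1] at hB
  obtain ⟨z, hz⟩ : ∃ z, B.1 0 1 = z * A.1 0 1 := ⟨B.1 0 1 / A.1 0 1, by field_simp⟩
  have hp : 2 * B.1 0 0 + 1 = z * (2 * A.1 0 0 + 1) := by
    apply mul_left_cancel₀ hb
    linear_combination -e01 + (2 * A.1 0 0 + 1) * hz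
  have hr : B.1 1 0 = z * A.1 1 0 := by
    apply mul_left_cancel₀ hb
    linear_combination e00 + A.1 1 0 * hz
  have hz2 : z ^ 2 = 1 := by
    rw [hz, hr] at hB
    linear_combination (4 / 3) * hB - (4 / 3) * z ^ 2 * hA +
      (1 / 3) * (2 * B.1 0 0 + 1 + z * (2 * A.1 0 0 + 1)) * hp
  rcases sq_eq_one_iff.mp hz2 with rfl | rfl
  · left
    apply Subtype.ext
    ext i j
    fin_cases i <;> fin_cases j <;> simp <;> linarith
  · right
    apply Subtype.ext
    rw [Matrix.SpecialLinearGroup.coe_mul, hAA]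
    ext i j
    fin_cases i <;> fin_cases j <;> simp <;> linarith

/-- A trivial generator is replaced by a copy of the other one, which reduces to two generators of
trace `-1`; if both are trivial the image would be trivial. -/
lemma closure_pair_ne_range_sigmaHat {A C : SL(2, ℝ)} (hA : A ^ 3 = 1) (hC : C ^ 3 = 1) :
    Subgroup.closure {A, C} ≠ sigmaHat.range := by
  intro h
  rcases eq_one_or_trace_of_pow_three hA with rfl | tA <;>
    rcases eq_one_or_trace_of_pow_three hC with rfl | tC
  · have h0 : thetaHat 0 ∈ sigmaHat.range := ⟨loop 0, sigmaHat_loop 0⟩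
    rw [← h] at h0
    have h1 : thetaHat 0 = 1 := by
      rwa [Set.pair_eq_singleton, Subgroup.closure_singleton_one, Subgroup.mem_bot] at h0
    have := trace_thetaHat_zero
    rw [h1] at this
    norm_num [Matrix.trace_fin_two] at this
  · refine range_sigmaHat_ne_closure tC tC (h.symm.trans ?_)
    rw [Subgroup.closure_insert_one, Set.pair_eq_singleton]
  · refine range_sigmaHat_ne_closure tA tA (h.symm.trans ?_)
    rw [Set.pair_comm, Subgroup.closure_insert_one, Set.pair_eq_singleton]
  · exact range_sigmaHat_ne_closure tA tC h.symm

theorem not_commute_of_closure_eq_range {A B C : SL(2, ℝ)} (hA : A ^ 3 = 1) (hB : B ^ 3 = 1)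
    (hC : C ^ 3 = 1) (h : Subgroup.closure {A, B, C} = sigmaHat.range) : A * B ≠ B * A := by
  intro hAB
  have drop : B ∈ Subgroup.closure {A, C} → False := by
    intro hmem
    refine closure_pair_ne_range_sigmaHat hA hC (le_antisymm ?_ ?_)
    · rw [← h]
      refine Subgroup.closure_mono ?_
      rintro z (rfl | rfl) <;> simp
    · rw [← h, Subgroup.closure_le]
      rintro z (rfl | rfl | rfl)
      · exact Subgroup.subset_closure (by simp)
      · exact hmem
      · exact Subgroup.subset_closure (by simp)
  have hAmem : A ∈ Subgroup.closure {A, C} := Subgroup.subset_closure (by simp)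
  rcases eq_one_or_trace_of_pow_three hA with rfl | tA
  · rw [Subgroup.closure_insert_one] at h
    exact closure_pair_ne_range_sigmaHat hB hC h
  rcases eq_one_or_trace_of_pow_three hB with rfl | tB
  · exact drop (one_mem _)
  rcases eq_or_eq_mul_self_of_commute tA tB hAB with rfl | rfl
  · exact drop hAmem
  · exact drop (mul_mem hAmem hAmem)

/-! ### Irreducibility -/

lemma realAction_conj {G V : Type*} [Group G] [AddCommGroup V] [Module ℝ V] {n : ℕ}
    {ρ : G →* SL(n, ℤ)} {τ : Representation ℝ G V} {b : Module.Basis (Fin n) ℝ V}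
    (hb : ∀ g : G, LinearMap.toMatrix b b (τ g) =
      (ρ g : Matrix (Fin n) (Fin n) ℤ).map (Int.castRingHom ℝ)) (g : G) (v : V) :
    realAction ρ g (b.equivFun v) = b.equivFun (τ g v) := by
  change Matrix.toLin' ((ρ g : Matrix (Fin n) (Fin n) ℤ).map (Int.castRingHom ℝ)) _ = _
  rw [← hb, Matrix.toLin'_apply]
  exact LinearMap.toMatrix_mulVec_repr b b (τ g) v

theorem isIrreducible_restrictTo {k : ℕ} {ρ : Pi1 →* SL(2 * k + 1, ℤ)}
    (hρ : IsIntegralConjugate ρ (omegaSigma k)) {H : Subgroup Pi1} {u w : Pi1} (hu : u ∈ H)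
    (hw : w ∈ H) (hu3 : u ^ 3 = 1) (hw3 : w ^ 3 = 1)
    (huw : sigmaHat u * sigmaHat w ≠ sigmaHat w * sigmaHat u) :
    (restrictTo (realAction ρ) H).IsIrreducible := by
  obtain ⟨b, hb⟩ := hρ
  have htr : ∀ z : Pi1, z ^ 3 = 1 → sigmaHat z ≠ 1 → (sigmaHat z).1.trace = -1 := fun z hz hz1 =>
    (eq_one_or_trace_of_pow_three (by rw [← map_pow, hz, map_one])).resolve_left hz1
  have tu := htr u hu3 (fun e => huw (by rw [e, one_mul, mul_one]))
  have tw := htr w hw3 (fun e => huw (by rw [e, one_mul, mul_one]))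
  have : Nontrivial (Subrepresentation (restrictTo (realAction ρ) H)) := by
    refine ⟨⊥, ⊤, fun e => ?_⟩
    have := congrArg Subrepresentation.toSubmodule e
    exact bot_ne_top (α := Submodule ℝ (Fin (2 * k + 1) → ℝ)) this
  refine ⟨fun S => ?_⟩
  -- The subrepresentation is pulled back along the basis to a space of binary forms, where
  -- `eq_bot_or_eq_binaryForm` applies to `u` and `w`.
  set V := S.toSubmodule.comap b.equivFun.toLinearMap with hV
  have hinv : ∀ z ∈ H, ∀ P ∈ V.map (BinaryForm (2 * k)).subtype,
      subst (sigmaHat z).1 P ∈ V.map (BinaryForm (2 * k)).subtype := by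
    rintro z hz _ ⟨P, hP, rfl⟩
    refine ⟨omegaSigma k z P, ?_, ?_⟩
    · change b.equivFun (omegaSigma k z P) ∈ S.toSubmodule
      rw [← realAction_conj hb]
      exact S.apply_mem_toSubmodule ⟨z, hz⟩ hP
    · rw [omegaSigma_eq]
      rfl
  have hS : S.toSubmodule = V.map b.equivFun.toLinearMap :=
    (Submodule.map_comap_eq_of_surjective b.equivFun.surjective _).symm
  rcases eq_bot_or_eq_binaryForm (Submodule.map_subtype_le _ V) tu tw huw (hinv u hu)
    (hinv w hw) with h | h
  · left
    apply Subrepresentation.toSubmodule_injective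
    have hV0 : V = ⊥ := by
      apply Submodule.map_injective_of_injective (BinaryForm (2 * k)).injective_subtype
      rw [h, Submodule.map_bot]
    rw [hS, hV0, Submodule.map_bot]
    rfl
  · right
    apply Subrepresentation.toSubmodule_injective
    have hV1 : V = ⊤ := by
      apply Submodule.map_injective_of_injective (BinaryForm (2 * k)).injective_subtype
      rw [h, Submodule.map_subtype_top]
    rw [hS, hV1, Submodule.map_top, LinearEquiv.range]
    rfl

/-- Surjectivity of `φ` makes the images of the three loops generate all of `sigmaHat.range`; the
third loop `l` serves only this purpose. -/
lemma not_commute_of_mulEquiv (φ : Pi1 ≃* Pi1) {i j l : Fin 4}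
    (h : Subgroup.closure {loop i, loop j, loop l} = ⊤) :
    sigmaHat (φ (loop i)) * sigmaHat (φ (loop j)) ≠
      sigmaHat (φ (loop j)) * sigmaHat (φ (loop i)) := by
  have h3 : ∀ i, sigmaHat (φ (loop i)) ^ 3 = 1 := fun i => by
    rw [← map_pow, ← map_pow, loop_pow_three, map_one, map_one]
  refine not_commute_of_closure_eq_range (h3 i) (h3 j) (h3 l) ?_
  have := congrArg (Subgroup.map (sigmaHat.comp φ.toMonoidHom)) h
  rw [MonoidHom.map_closure, ← MonoidHom.range_eq_map, MonoidHom.range_comp,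
    MonoidHom.range_eq_top_of_surjective _ φ.surjective, ← MonoidHom.range_eq_map] at this
  rw [← this]
  simp [Set.image_insert_eq]

end Orbifold3333

end

theorem proposition4p3 (k : ℕ) (ρ : Orbifold3333.Pi1 →* SL(2 * k + 1, ℤ))
    (hρ : Orbifold3333.IsIntegralConjugate ρ (Orbifold3333.omegaSigma k))
    (c : Orbifold3333.Pi1) (L R : Subgroup Orbifold3333.Pi1)
    (hsplit : Orbifold3333.IsSplitting c L R) :
    (Orbifold3333.restrictTo (Orbifold3333.realAction ρ) L).IsIrreducible ∧
      (Orbifold3333.restrictTo (Orbifold3333.realAction ρ) R).IsIrreducible := by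
  obtain ⟨φ, -, rfl, rfl⟩ := hsplit
  have h3 : ∀ i, φ (Orbifold3333.loop i) ^ 3 = 1 := fun i => by
    rw [← map_pow, Orbifold3333.loop_pow_three, map_one]
  exact ⟨Orbifold3333.isIrreducible_restrictTo hρ (Subgroup.subset_closure (by simp))
      (Subgroup.subset_closure (by simp)) (h3 0) (h3 1)
      (Orbifold3333.not_commute_of_mulEquiv φ Orbifold3333.closure_loop_zero_one_two),
    Orbifold3333.isIrreducible_restrictTo hρ (Subgroup.subset_closure (by simp))
      (Subgroup.subset_closure (by simp)) (h3 2) (h3 3)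
      (Orbifold3333.not_commute_of_mulEquiv φ Orbifold3333.closure_loop_two_three_zero)⟩
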